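/- Let $T_0(x)=1$ and, for $j\ge 1$, let $T_j(x)$ be the monic polynomial with $T_j(z+z^{-1})=z^j+z^{-j}$ (equivalently $T_j(2\cos\theta)=2\cos(j\theta)$). For integers $k\ge 0$ and $n\ge 1$ let $$P_{2n+k-1}(x)=T_{2n+k-1}(x)-\sum_{i=0}^{n-1}T_{2i}(x),$$ i.e. the polynomial of degree $2n+k-1$ whose coordinates in the basis $(T_0,T_1,T_2,\dots)$ are $[-1,0,-1,0,\dots,-1,\underbrace{0,\dots,0}_{k},1]$ with $n$ entries $-1$. Let $k\in\{0,1,2,3,5,7\}$. The polynomial $z^{k+1}-z^{k-1}-1$ (for $k=0$: $z^2-z-1$) has a largest real root $z_0$. For every $n\ge 1$ the polynomial $P_{2n+k-1}$ is hyperbolic (all its complex roots are real), and for every $n\ge 2$ the following holds. (a) If $k$ is even, then, counting multiplicities, all roots of $P_{2n+k-1}$ lie in $[-2,2]$ except exactly one, $x_M=x_M(n)$, and $x_M>2$. As $n\to\infty$, $x_M\to z_0+z_0^{-1}$ and the smallest root of $P_{2n+k-1}$ tends to $-2$. (b) If $k$ is odd, then, counting multiplicities, all roots of $P_{2n+k-1}$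 lie in $[-2,2]$ except exactly two, $x_M=x_M(n)>2$ and $-x_M<-2$. As $n\to\infty$, $x_M\to z_0+z_0^{-1}$ and the smallest root of $P_{2n+k-1}$ (which is $-x_M$) tends to $-(z_0+z_0^{-1})$. -/

import Mathlib

open Polynomial Filter Topology

noncomputable section

/-- The monic Chebyshev polynomials on `[-2, 2]`: `T₀ = 1`, and for `j ≥ 1` the polynomial `T_j`
is the rescaled Chebyshev polynomial with `T_j (z + z⁻¹) = z ^ j + z⁻¹ ^ j`,
that is `T_j (2 cos θ) = 2 cos (j θ)`. -/
def chebBasis (j : ℕ) : ℝ[X] :=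
  if j = 0 then 1 else Chebyshev.C ℝ (j : ℤ)

/-- The polynomial with Chebyshev coordinates `[a₀, a₁, …, a_d]`, namely `∑ a_j T_j`. -/
def ofChebCoords (a : List ℝ) : ℝ[X] :=
  ∑ j ∈ Finset.range a.length, C (a.getD j 0) * chebBasis j

/-- The coordinates `[-1, 0, -1, 0, …, -1, 0, …, 0, 1]`, where for `n ≥ 1` the number of entries
`-1` is `n` (each but the last one followed by a single `0`), and the last `-1` and the final `1`
are separated by `k` zeros. -/
def familyCoords (k n : ℕ) : List ℝ :=
  (List.replicate (n - 1) [-1, 0]).flatten ++ [-1] ++ List.replicate k 0 ++ [1]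

/-- The polynomial `P_{2n+k-1}`, of degree `2n+k-1`, with the above Chebyshev coordinates. -/
def familyPoly (k n : ℕ) : ℝ[X] :=
  ofChebCoords (familyCoords k n)

/-- A real polynomial is hyperbolic if it is nonzero and all of its complex roots are real. -/
def IsHyperbolic (p : ℝ[X]) : Prop :=
  p ≠ 0 ∧ ∀ z : ℂ, aeval z p = 0 → z.im = 0

/-- The polynomial `z^(k+1) - z^(k-1) - 1`, replaced by `z^2 - z - 1` for `k = 0`. -/
def limitPoly (k : ℕ) : ℝ[X] :=
  if k = 0 then X ^ 2 - X - 1 else X ^ (k + 1) - X ^ (k - 1) - 1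

end

/-! ### The Chebyshev basis and the shape of the family -/

/-! Write `n = m + 1`. The sum of the even `T_{2i}` telescopes after multiplication by `sin θ` (for
`x = 2 cos θ`) or by `z - z⁻¹` (for `x = z + z⁻¹`), so each range of `x` has a closed formula.

Inside `[-2, 2]`, `sin θ · P = 2 sin θ cos((2m+1+k)θ) - sin((2m+1)θ)`. Choose a frequency `c` from
`2m+1` to `2m+1+k` and test where `cθ` is an integral, or half-integral, multiple of `π`: the right
side becomes an alternating sign times a factor of low frequency, independent of `m`. For the listed
`k` this factor is `2 sin θ`, `3 sin θ`, `cos(θ/2)`, `2 sin 2θ`, `cos θ`, `cos 2θ` respectively. Its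
sign is controlled on the range needed: `(0, π)` for even `k`, and by parity of `P` only `(0, π/2)`
for odd `k`. The sole sign change, for `k = 7` at `π/4`, is repaired by one more test point.

Outside, `(z - z⁻¹) P = z^(2m+1) g(z) + z^(-(2m+1)) (positive)` with `g(z) = (z - z⁻¹) z^k - 1`,
which is the limit polynomial up to a factor `z` when `k = 0`. Since `P(2) = 1 - 2m < 0` for `m ≥ 1`
and `P > 0` at `z₀`, there is a root beyond `2`.

Interior and exterior roots together number the degree, so they are all the roots and are simple
(`roots_eq_val_of_natDegree_le_card`). The limits come from the sign of `g` left of `z₀`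
(`tendsto_exterior_root`) and, for even `k`, from a sign change squeezed against `-2`. -/

lemma natDegree_chebyshevC_le (j : ℕ) : (Chebyshev.C ℝ (j : ℤ)).natDegree ≤ j := by
  induction j using Nat.twoStepInduction with
  | zero => simp
  | one => simp
  | more j h0 h1 =>
    have h : Chebyshev.C ℝ ((j + 1 + 1 : ℕ) : ℤ) =
        X * Chebyshev.C ℝ ((j + 1 : ℕ) : ℤ) - Chebyshev.C ℝ (j : ℤ) := by
      push_cast
      rw [add_assoc, one_add_one_eq_two, Chebyshev.C_add_two]
    rw [h]
    refine (natDegree_sub_le _ _).trans (max_le ?_ (by omega))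
    refine natDegree_mul_le.trans ?_
    rw [natDegree_X]
    omega

lemma eval_neg_chebyshevC (j : ℕ) (x : ℝ) :
    (Chebyshev.C ℝ (j : ℤ)).eval (-x) = (-1) ^ j * (Chebyshev.C ℝ (j : ℤ)).eval x := by
  induction j using Nat.twoStepInduction with
  | zero => simp
  | one => simp
  | more j h0 h1 =>
    have h : Chebyshev.C ℝ ((j + 1 + 1 : ℕ) : ℤ) =
        X * Chebyshev.C ℝ ((j + 1 : ℕ) : ℤ) - Chebyshev.C ℝ (j : ℤ) := by
      push_cast
      rw [add_assoc, one_add_one_eq_two, Chebyshev.C_add_two]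
    rw [h]
    simp only [eval_sub, eval_mul, eval_X, h0, h1]
    ring

lemma eval_add_inv_chebyshevC (j : ℕ) {z : ℝ} (hz : z ≠ 0) :
    (Chebyshev.C ℝ (j : ℤ)).eval (z + z⁻¹) = z ^ j + z⁻¹ ^ j := by
  induction j using Nat.twoStepInduction with
  | zero => simp; norm_num
  | one => simp
  | more j h0 h1 =>
    have h : Chebyshev.C ℝ ((j + 1 + 1 : ℕ) : ℤ) =
        X * Chebyshev.C ℝ ((j + 1 : ℕ) : ℤ) - Chebyshev.C ℝ (j : ℤ) := by
      push_cast
      rw [add_assoc, one_add_one_eq_two, Chebyshev.C_add_two]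
    rw [h]
    simp only [eval_sub, eval_mul, eval_X, h0, h1]
    have : z * z⁻¹ = 1 := mul_inv_cancel₀ hz
    linear_combination (z ^ j + z⁻¹ ^ j) * this

lemma chebBasis_of_ne_zero {j : ℕ} (hj : j ≠ 0) : chebBasis j = Chebyshev.C ℝ (j : ℤ) := by
  simp [chebBasis, hj]

lemma natDegree_chebBasis_le (j : ℕ) : (chebBasis j).natDegree ≤ j := by
  unfold chebBasis
  split_ifs
  · simp
  · exact natDegree_chebyshevC_le j

lemma eval_neg_chebBasis (j : ℕ) (x : ℝ) :
    (chebBasis j).eval (-x) = (-1) ^ j * (chebBasis j).eval x := by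
  unfold chebBasis
  split_ifs with h
  · simp [h]
  · exact eval_neg_chebyshevC j x

lemma ofChebCoords_append (a b : List ℝ) :
    ofChebCoords (a ++ b) = ofChebCoords a +
      ∑ j ∈ Finset.range b.length, C (b.getD j 0) * chebBasis (a.length + j) := by
  unfold ofChebCoords
  rw [List.length_append, Finset.sum_range_add]
  congr 1
  · refine Finset.sum_congr rfl fun j hj => ?_
    rw [List.getD_append _ _ _ _ (Finset.mem_range.1 hj)]
  · refine Finset.sum_congr rfl fun j _ => ?_
    rw [List.getD_append_right _ _ _ _ (Nat.le_add_right _ _), Nat.add_sub_cancel_left]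

lemma ofChebCoords_flatten_replicate (m : ℕ) :
    ofChebCoords (List.replicate m [-1, 0]).flatten =
      -∑ i ∈ Finset.range m, chebBasis (2 * i) := by
  induction m with
  | zero => simp [ofChebCoords]
  | succ m ih =>
    rw [List.replicate_succ', List.flatten_append, ofChebCoords_append, ih,
      Finset.sum_range_succ]
    simp [Finset.sum_range_succ, mul_comm]
    ring

/-- Indexing by `n = m + 1` removes the truncated subtraction in `familyCoords`. -/
lemma familyPoly_succ (k m : ℕ) :
    familyPoly k (m + 1) =
      chebBasis (2 * m + 1 + k) - ∑ i ∈ Finset.range (m + 1), chebBasis (2 * i) := by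
  unfold familyPoly familyCoords
  rw [ofChebCoords_append, ofChebCoords_append, ofChebCoords_append, Nat.add_sub_cancel,
    ofChebCoords_flatten_replicate, Finset.sum_range_succ]
  simp [mul_comm m]
  ring_nf

lemma natDegree_familyPoly_le (k m : ℕ) : (familyPoly k (m + 1)).natDegree ≤ 2 * m + 1 + k := by
  rw [familyPoly_succ]
  refine (natDegree_sub_le _ _).trans (max_le (natDegree_chebBasis_le _) ?_)
  refine natDegree_sum_le_of_forall_le _ _ fun i hi => (natDegree_chebBasis_le _).trans ?_
  have := Finset.mem_range.1 hi
  omega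

lemma eval_neg_familyPoly {k : ℕ} (hk : Odd k) (m : ℕ) (x : ℝ) :
    (familyPoly k (m + 1)).eval (-x) = (familyPoly k (m + 1)).eval x := by
  have hd : Even (2 * m + 1 + k) := by
    obtain ⟨l, rfl⟩ := hk
    exact ⟨m + 1 + l, by ring⟩
  rw [familyPoly_succ]
  simp [eval_finsetSum, eval_neg_chebBasis, hd.neg_one_pow]

/-! ### Evaluation on the segment `[-2, 2]` and outside of it -/

/-- Telescoping of `2 sin θ cos(2iθ) = sin((2i+1)θ) - sin((2i-1)θ)`. The convention `T₀ = 1`, rather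
than `2`, makes the first term exactly `sin θ`. -/
lemma sin_mul_eval_sum (m : ℕ) (θ : ℝ) :
    Real.sin θ * (∑ i ∈ Finset.range (m + 1), chebBasis (2 * i)).eval (2 * Real.cos θ) =
      Real.sin ((2 * m + 1) * θ) := by
  induction m with
  | zero => simp [chebBasis]
  | succ m ih =>
    rw [Finset.sum_range_succ, eval_add, mul_add, ih, chebBasis_of_ne_zero (by omega),
      Chebyshev.C_two_mul_real_cos]
    push_cast
    rw [show (2 * ((m : ℝ) + 1) + 1) * θ = 2 * (m + 1) * θ + θ by ring,
      show (2 * (m : ℝ) + 1) * θ = 2 * (m + 1) * θ - θ by ring, Real.sin_add, Real.sin_sub]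
    ring

lemma sin_mul_eval_familyPoly (k m : ℕ) (θ : ℝ) :
    Real.sin θ * (familyPoly k (m + 1)).eval (2 * Real.cos θ) =
      2 * Real.sin θ * Real.cos ((2 * m + 1 + k) * θ) - Real.sin ((2 * m + 1) * θ) := by
  rw [familyPoly_succ, eval_sub, mul_sub, sin_mul_eval_sum, chebBasis_of_ne_zero (by omega),
    Chebyshev.C_two_mul_real_cos]
  push_cast
  ring

lemma sub_inv_mul_eval_sum (m : ℕ) {z : ℝ} (hz : z ≠ 0) :
    (z - z⁻¹) * (∑ i ∈ Finset.range (m + 1), chebBasis (2 * i)).eval (z + z⁻¹) =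
      z ^ (2 * m + 1) - z⁻¹ ^ (2 * m + 1) := by
  have h : z * z⁻¹ = 1 := mul_inv_cancel₀ hz
  induction m with
  | zero => simp [chebBasis]
  | succ m ih =>
    rw [Finset.sum_range_succ, eval_add, mul_add, ih, chebBasis_of_ne_zero (by omega),
      eval_add_inv_chebyshevC _ hz]
    linear_combination (-z ^ (2 * m + 1) + z⁻¹ ^ (2 * m + 1)) * h

lemma sub_inv_mul_eval_familyPoly (k m : ℕ) {z : ℝ} (hz : z ≠ 0) :
    (z - z⁻¹) * (familyPoly k (m + 1)).eval (z + z⁻¹) =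
      (z - z⁻¹) * (z ^ (2 * m + 1 + k) + z⁻¹ ^ (2 * m + 1 + k)) -
        (z ^ (2 * m + 1) - z⁻¹ ^ (2 * m + 1)) := by
  rw [familyPoly_succ, eval_sub, mul_sub, sub_inv_mul_eval_sum _ hz,
    chebBasis_of_ne_zero (by omega), eval_add_inv_chebyshevC _ hz]

lemma eval_two_familyPoly (k m : ℕ) : (familyPoly k (m + 1)).eval 2 = 1 - 2 * m := by
  have h : ∀ i : ℕ, (chebBasis (2 * i)).eval 2 = if i = 0 then 1 else 2 := by
    intro i
    by_cases hi : i = 0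
    · simp [hi, chebBasis]
    · rw [chebBasis_of_ne_zero (by omega), Chebyshev.C_eval_two, if_neg hi]
  rw [familyPoly_succ, eval_sub, chebBasis_of_ne_zero (by omega), Chebyshev.C_eval_two,
    eval_finsetSum, Finset.sum_range_succ']
  simp [h, show chebBasis 0 = 1 from if_pos rfl]
  ring

lemma eval_neg_two_familyPoly {k : ℕ} (hk : Even k) (m : ℕ) :
    (familyPoly k (m + 1)).eval (-2) = -3 - 2 * m := by
  have h : ∀ i : ℕ, (chebBasis (2 * i)).eval (-2) = if i = 0 then 1 else 2 := by
    intro i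
    rw [eval_neg_chebBasis, pow_mul]
    by_cases hi : i = 0
    · simp [hi, chebBasis]
    · rw [chebBasis_of_ne_zero (by omega), Chebyshev.C_eval_two, if_neg hi]
      simp
  have hd : Odd (2 * m + 1 + k) := by
    obtain ⟨l, rfl⟩ := hk
    exact ⟨m + l, by ring⟩
  rw [familyPoly_succ, eval_sub, eval_neg_chebBasis, hd.neg_one_pow,
    chebBasis_of_ne_zero (by omega), Chebyshev.C_eval_two,
    eval_finsetSum, Finset.sum_range_succ']
  simp [h, show chebBasis 0 = 1 from if_pos rfl]
  ring

/-! ### Roots from sign changes -/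

lemma exists_root_of_eval_mul_neg (p : ℝ[X]) {a b : ℝ} (hab : a < b)
    (h : p.eval a * p.eval b < 0) : ∃ x, a < x ∧ x < b ∧ p.IsRoot x := by
  rcases mul_neg_iff.1 h with ⟨h1, h2⟩ | ⟨h1, h2⟩
  · obtain ⟨x, hx, h0⟩ := intermediate_value_Ioo' hab.le p.continuous.continuousOn ⟨h2, h1⟩
    exact ⟨x, hx.1, hx.2, h0⟩
  · obtain ⟨x, hx, h0⟩ := intermediate_value_Ioo hab.le p.continuous.continuousOn ⟨h1, h2⟩
    exact ⟨x, hx.1, hx.2, h0⟩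

/-- A polynomial whose values at `2 cos t₀ > ⋯ > 2 cos t_m` alternate in sign has `m` distinct
roots between the extreme points. -/
lemma exists_roots_of_alternating (p : ℝ[X]) (c : ℝ) (t : ℕ → ℝ) (m : ℕ) (h0 : 0 ≤ t 0)
    (hpi : t m ≤ Real.pi) (ht : ∀ j < m, t j < t (j + 1))
    (hs : ∀ j ≤ m, 0 < c * (-1) ^ j * p.eval (2 * Real.cos (t j))) :
    ∃ S : Finset ℝ, S.card = m ∧
      ∀ x ∈ S, 2 * Real.cos (t m) < x ∧ x < 2 * Real.cos (t 0) ∧ p.IsRoot x := by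
  have hmono : ∀ i j, i ≤ j → j ≤ m → t i ≤ t j := by
    intro i j hij
    induction j, hij using Nat.le_induction with
    | base => exact fun _ => le_rfl
    | succ j hij ih => exact fun hj => (ih (by omega)).trans (ht j (by omega)).le
  induction m with
  | zero => exact ⟨∅, by simp⟩
  | succ m ih =>
    obtain ⟨S, hcard, hS⟩ := ih ((ht m (by omega)).le.trans hpi) (fun j hj => ht j (by omega))
      (fun j hj => hs j (by omega)) (fun i j hij hj => hmono i j hij (by omega))
    have hcos : 2 * Real.cos (t (m + 1)) < 2 * Real.cos (t m) := by
      have := Real.cos_lt_cos_of_nonneg_of_le_pi (h0.trans (hmono 0 m (by omega) (by omega))) hpi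
        (ht m (by omega))
      linarith
    have hle : 2 * Real.cos (t m) ≤ 2 * Real.cos (t 0) := by
      have := Real.cos_le_cos_of_nonneg_of_le_pi h0 ((ht m (by omega)).le.trans hpi)
        (hmono 0 m (by omega) (by omega))
      linarith
    have hneg : p.eval (2 * Real.cos (t (m + 1))) * p.eval (2 * Real.cos (t m)) < 0 := by
      have h1 := mul_pos (hs m (by omega)) (hs (m + 1) le_rfl)
      -- Multiplying the two sign conditions cancels `(-1)^m` and leaves `c²`, so only the opposite
      -- signs at consecutive points matter.
      have h2 : ((-1 : ℝ) ^ m) ^ 2 = 1 := by rw [← pow_mul, mul_comm, pow_mul]; simp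
      have h3 : c * (-1) ^ m * p.eval (2 * Real.cos (t m)) *
          (c * (-1) ^ (m + 1) * p.eval (2 * Real.cos (t (m + 1)))) =
          c ^ 2 * (-(p.eval (2 * Real.cos (t (m + 1))) * p.eval (2 * Real.cos (t m)))) := by
        linear_combination (-c ^ 2 *
          (p.eval (2 * Real.cos (t (m + 1))) * p.eval (2 * Real.cos (t m)))) * h2
      rw [h3] at h1
      have := pos_of_mul_pos_right h1 (sq_nonneg c)
      linarith
    obtain ⟨x, hx1, hx2, hx⟩ := exists_root_of_eval_mul_neg p hcos hneg
    refine ⟨insert x S, ?_, ?_⟩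
    · rw [Finset.card_insert_of_notMem, hcard]
      intro hxS
      linarith [(hS x hxS).1]
    · intro y hy
      rcases Finset.mem_insert.1 hy with rfl | hy
      · exact ⟨hx1, by linarith, hx⟩
      · obtain ⟨h1, h2, h3⟩ := hS y hy
        exact ⟨by linarith, h2, h3⟩

/-- As many distinct roots as the degree allows leaves no room for further roots or multiplicities;
an upper bound on the degree is enough. -/
lemma roots_eq_val_of_natDegree_le_card {p : ℝ[X]} (hp : p ≠ 0) (S : Finset ℝ)
    (hS : ∀ x ∈ S, p.IsRoot x) (hd : p.natDegree ≤ S.card) : p.roots = S.val := by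
  refine (Multiset.eq_of_le_of_card_le ?_ ((card_roots' p).trans hd)).symm
  exact (Multiset.le_iff_subset S.nodup).2 fun x hx => (mem_roots hp).2 (hS x hx)

lemma isHyperbolic_of_natDegree_le_card {p : ℝ[X]} (hp : p ≠ 0) (S : Finset ℝ)
    (hS : ∀ x ∈ S, p.IsRoot x) (hd : p.natDegree ≤ S.card) : IsHyperbolic p := by
  refine ⟨hp, fun z hz => ?_⟩
  have hroots := roots_eq_val_of_natDegree_le_card hp S hS hd
  have hsplit : p.Splits := by
    refine splits_iff_card_roots.2 (le_antisymm (card_roots' p) ?_)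
    rw [hroots]
    exact hd
  have hz' : z ∈ (p.map (algebraMap ℝ ℂ)).roots :=
    (mem_roots ((Polynomial.map_ne_zero_iff (algebraMap ℝ ℂ).injective).2 hp)).2
      (by rwa [IsRoot.def, eval_map_algebraMap])
  rw [hsplit.roots_map, Multiset.mem_map] at hz'
  obtain ⟨x, -, rfl⟩ := hz'
  simp

/-! ### The limit polynomial and the exterior root -/

lemma two_lt_add_inv {z : ℝ} (hz : 1 < z) : 2 < z + z⁻¹ := by
  have h0 : 0 < z := by linarith
  have h : z + z⁻¹ - 2 = (z - 1) ^ 2 * z⁻¹ := by field_simp; ring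
  have : 0 < (z - 1) ^ 2 * z⁻¹ := mul_pos (pow_pos (by linarith) 2) (inv_pos.2 h0)
  linarith

lemma add_inv_lt_add_inv {z w : ℝ} (hz : 1 < z) (hzw : z < w) : z + z⁻¹ < w + w⁻¹ := by
  have hw : 0 < w := by linarith
  have h0 : 0 < z := by linarith
  have h : w + w⁻¹ - (z + z⁻¹) = (w - z) * (z * w - 1) * (z⁻¹ * w⁻¹) := by field_simp; ring
  have : 0 < (w - z) * (z * w - 1) * (z⁻¹ * w⁻¹) :=
    mul_pos (mul_pos (by linarith) (by nlinarith)) (mul_pos (inv_pos.2 h0) (inv_pos.2 hw))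
  linarith

/-- Gives uniqueness of the root of the limit polynomial beyond `1`, and the sign on either side of
it. -/
lemma strictMonoOn_sub_inv_mul_pow (k : ℕ) :
    StrictMonoOn (fun z : ℝ => (z - z⁻¹) * z ^ k) (Set.Ici 1) := by
  intro z hz w hw hzw
  have hz1 : (1 : ℝ) ≤ z := hz
  have hw1 : (1 : ℝ) ≤ w := hw
  have hinv : w⁻¹ < z⁻¹ := inv_strictAnti₀ (by linarith) hzw
  have hwinv : w⁻¹ ≤ 1 := inv_le_one_of_one_le₀ hw1
  calc (z - z⁻¹) * z ^ k < (w - w⁻¹) * z ^ k :=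
        mul_lt_mul_of_pos_right (by linarith) (by positivity)
    _ ≤ (w - w⁻¹) * w ^ k :=
        mul_le_mul_of_nonneg_left (by gcongr) (by linarith)

lemma eval_limitPoly (k : ℕ) {z : ℝ} (hz : 0 < z) :
    (limitPoly k).eval z = (if k = 0 then z else 1) * ((z - z⁻¹) * z ^ k - 1) := by
  have h : z * z⁻¹ = 1 := mul_inv_cancel₀ hz.ne'
  rcases k with _ | k
  · simp [limitPoly]
    linear_combination h
  · simp [limitPoly]
    linear_combination (z ^ k) * h

/-- The largest root `z₀` of the limit polynomial separates the signs of `(z - z⁻¹) z ^ k - 1`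
on `z > 1`. -/
lemma exists_isGreatest_root_limitPoly (k : ℕ) :
    ∃ z₀ : ℝ, 1 < z₀ ∧ IsGreatest {z : ℝ | (limitPoly k).IsRoot z} z₀ ∧
      (z₀ - z₀⁻¹) * z₀ ^ k - 1 = 0 ∧ ∀ z, 1 < z → z < z₀ → (z - z⁻¹) * z ^ k - 1 < 0 := by
  have hc : ∀ z : ℝ, 0 < z → (0 : ℝ) < if k = 0 then z else 1 := fun z hz => by
    split_ifs <;> simp [hz]
  have h1 : (limitPoly k).eval 1 < 0 := by
    rw [eval_limitPoly k one_pos]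
    simp
  have h2 : 0 < (limitPoly k).eval 2 := by
    rw [eval_limitPoly k two_pos]
    refine mul_pos (hc 2 two_pos) ?_
    have : (1 : ℝ) ≤ 2 ^ k := one_le_pow₀ (by norm_num)
    linarith
  obtain ⟨z₀, hz1, -, hz₀⟩ := exists_root_of_eval_mul_neg (limitPoly k) (by norm_num : (1 : ℝ) < 2)
    (mul_neg_of_neg_of_pos h1 h2)
  have hpos : 0 < z₀ := by linarith
  have hg : (z₀ - z₀⁻¹) * z₀ ^ k - 1 = 0 := by
    have h := hz₀
    rw [IsRoot.def, eval_limitPoly k hpos] at h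
    exact (mul_eq_zero.1 h).resolve_left (hc z₀ hpos).ne'
  refine ⟨z₀, hz1, ⟨hz₀, fun z hz => ?_⟩, hg, fun z hz hzz => ?_⟩
  · by_contra! hlt
    have hmono := strictMonoOn_sub_inv_mul_pow k (Set.mem_Ici.2 hz1.le)
      (Set.mem_Ici.2 (hz1.trans hlt).le) hlt
    have h : (limitPoly k).eval z = 0 := hz
    rw [eval_limitPoly k (hpos.trans hlt)] at h
    have := (mul_eq_zero.1 h).resolve_left (hc z (hpos.trans hlt)).ne'
    simp only at hmono
    linarith
  · have hmono := strictMonoOn_sub_inv_mul_pow k (Set.mem_Ici.2 hz.le)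
      (Set.mem_Ici.2 hz1.le) hzz
    simp only at hmono
    linarith

/-- Separates the growing part, whose sign is that of the limit polynomial for `z > 1`, from a
positive decaying remainder. -/
lemma sub_inv_mul_eval_familyPoly' (k m : ℕ) {z : ℝ} (hz : z ≠ 0) :
    (z - z⁻¹) * (familyPoly k (m + 1)).eval (z + z⁻¹) =
      z ^ (2 * m + 1) * ((z - z⁻¹) * z ^ k - 1) +
        z⁻¹ ^ (2 * m + 1) * ((z - z⁻¹) * z⁻¹ ^ k + 1) := by
  rw [sub_inv_mul_eval_familyPoly k m hz]
  ring

/-- Equality in `hg` is allowed so that this applies at `z₀` itself, for every `m`. -/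
lemma eval_familyPoly_pos {k : ℕ} (m : ℕ) {z : ℝ} (hz : 1 < z)
    (hg : 0 ≤ (z - z⁻¹) * z ^ k - 1) : 0 < (familyPoly k (m + 1)).eval (z + z⁻¹) := by
  have h0 : 0 < z := by linarith
  have hsub : 0 < z - z⁻¹ := by linarith [inv_lt_one_of_one_lt₀ hz]
  refine pos_of_mul_pos_right (a := z - z⁻¹) ?_ hsub.le
  rw [sub_inv_mul_eval_familyPoly' k m h0.ne']
  positivity

lemma eventually_eval_familyPoly_neg {k : ℕ} {z : ℝ} (hz : 1 < z)
    (hg : (z - z⁻¹) * z ^ k - 1 < 0) :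
    ∀ᶠ m in atTop, (familyPoly k (m + 1)).eval (z + z⁻¹) < 0 := by
  have h0 : 0 < z := by linarith
  have hsub : 0 < z - z⁻¹ := by linarith [inv_lt_one_of_one_lt₀ hz]
  have hlim : Tendsto (fun m : ℕ => z ^ (2 * m + 1) * ((z - z⁻¹) * z ^ k - 1)) atTop atBot := by
    refine Tendsto.atTop_mul_const_of_neg hg ?_
    exact (tendsto_pow_atTop_atTop_of_one_lt hz).comp
      (tendsto_atTop_mono (fun m => show m ≤ 2 * m + 1 by omega) tendsto_id)
  filter_upwards [hlim.eventually_lt_atBot (-((z - z⁻¹) * z⁻¹ ^ k + 1))] with m hm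
  have h := sub_inv_mul_eval_familyPoly' k m h0.ne'
  have hle : z⁻¹ ^ (2 * m + 1) ≤ 1 := pow_le_one₀ (by positivity) (inv_lt_one_of_one_lt₀ hz).le
  have hpos : 0 < (z - z⁻¹) * z⁻¹ ^ k + 1 := by positivity
  have := mul_le_mul_of_nonneg_right hle hpos.le
  refine neg_of_mul_neg_right (a := z - z⁻¹) ?_ hsub.le
  linarith

lemma familyPoly_ne_zero (k m : ℕ) : familyPoly k (m + 1) ≠ 0 := by
  intro h
  have h2 := eval_two_familyPoly k m
  rw [h, eval_zero] at h2
  have : (2 * m : ℝ) = 1 := by linarith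
  norm_cast at this
  omega

lemma exists_root_familyPoly_gt_two {k m : ℕ} (hm : 1 ≤ m) :
    ∃ x, 2 < x ∧ (familyPoly k (m + 1)).IsRoot x := by
  obtain ⟨z₀, hz1, -, hg, -⟩ := exists_isGreatest_root_limitPoly k
  have h2 : (familyPoly k (m + 1)).eval 2 < 0 := by
    rw [eval_two_familyPoly]
    have : (1 : ℝ) ≤ m := by exact_mod_cast hm
    linarith
  obtain ⟨x, hx, -, h⟩ := exists_root_of_eval_mul_neg (familyPoly k (m + 1)) (two_lt_add_inv hz1)
    (mul_neg_of_neg_of_pos h2 (eval_familyPoly_pos m hz1 hg.ge))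
  exact ⟨x, hx, h⟩

/-- If the root greater than `2` is unique, then it tends to `z₀ + z₀⁻¹`. -/
lemma tendsto_exterior_root {k : ℕ} {z₀ : ℝ} (hz1 : 1 < z₀)
    (hg : (z₀ - z₀⁻¹) * z₀ ^ k - 1 = 0)
    (hneg : ∀ z, 1 < z → z < z₀ → (z - z⁻¹) * z ^ k - 1 < 0) {x : ℕ → ℝ}
    (hx : ∀ m, 1 ≤ m → ∀ y, 2 < y → (familyPoly k (m + 1)).IsRoot y → y = x (m + 1)) :
    Tendsto x atTop (𝓝 (z₀ + z₀⁻¹)) := by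
  -- A sign change between `z + z⁻¹` and `z₀ + z₀⁻¹` yields a root there, and uniqueness identifies
  -- it with `x (m + 1)`.
  have key : ∀ z, 1 < z → z < z₀ → ∀ᶠ m in atTop, z + z⁻¹ < x (m + 1) ∧
      x (m + 1) < z₀ + z₀⁻¹ := by
    intro z hz hzz
    filter_upwards [eventually_eval_familyPoly_neg hz (hneg z hz hzz), eventually_ge_atTop 1]
      with m hm h1
    obtain ⟨y, hy1, hy2, hy⟩ := exists_root_of_eval_mul_neg (familyPoly k (m + 1))
      (add_inv_lt_add_inv hz hzz) (mul_neg_of_neg_of_pos hm (eval_familyPoly_pos m hz1 hg.ge))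
    rw [← hx m h1 y ((two_lt_add_inv hz).trans hy1) hy]
    exact ⟨hy1, hy2⟩
  rw [← tendsto_add_atTop_iff_nat 1, tendsto_order]
  constructor
  · intro a ha
    have hcont : Tendsto (fun z : ℝ => z + z⁻¹) (𝓝[<] z₀) (𝓝 (z₀ + z₀⁻¹)) :=
      tendsto_nhdsWithin_of_tendsto_nhds
        (tendsto_id.add (tendsto_inv₀ (by linarith : z₀ ≠ 0)))
    obtain ⟨z, hz, hz'⟩ := ((hcont.eventually (lt_mem_nhds ha)).and
      (Ioo_mem_nhdsLT hz1)).exists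
    filter_upwards [key z hz'.1 hz'.2] with m hm
    exact hz.trans hm.1
  · intro b hb
    obtain ⟨z, hz, hzz⟩ := exists_between hz1
    filter_upwards [key z hz hzz] with m hm
    exact hm.2.trans hb

/-! ### Sign changes of the family on `[-2, 2]` -/

/-- Variant of `exists_roots_of_alternating` with a separate last point. -/
lemma exists_roots_of_alternating_of_last (p : ℝ[X]) (t : ℕ → ℝ) (b : ℝ) (m : ℕ)
    (h0 : 0 ≤ t 0) (hpi : b ≤ Real.pi) (ht : ∀ j, t j < t (j + 1)) (hb : t m < b)
    (hs : ∀ j ≤ m, 0 < -1 * (-1) ^ j * p.eval (2 * Real.cos (t j)))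
    (hsb : 0 < -1 * (-1) ^ (m + 1) * p.eval (2 * Real.cos b)) :
    ∃ S : Finset ℝ, S.card = m + 1 ∧
      ∀ x ∈ S, 2 * Real.cos b < x ∧ x < 2 * Real.cos (t 0) ∧ p.IsRoot x := by
  have h := exists_roots_of_alternating p (-1) (fun j => if j ≤ m then t j else b) (m + 1)
    (by simpa using h0) (by simpa using hpi) (fun j hj => ?_) (fun j hj => ?_)
  · simpa using h
  · rcases Nat.lt_succ_iff_lt_or_eq.1 hj with hj | rfl
    · simp [hj.le, Nat.succ_le_of_lt hj, ht j]
    · simp [hb]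
  · rcases Nat.lt_succ_iff_lt_or_eq.1 (Nat.lt_succ_of_le hj) with hj | rfl
    · rw [if_pos (by omega)]
      exact hs j (by omega)
    · rw [if_neg (by omega)]
      exact hsb

lemma neg_one_pow_mul_eval_familyPoly_pos {k m j : ℕ} {θ s : ℝ} (h0 : 0 < θ) (hpi : θ < Real.pi)
    (hs : 0 < s) (h : 2 * Real.sin θ * Real.cos ((2 * m + 1 + k) * θ) -
      Real.sin ((2 * m + 1) * θ) = -1 * (-1) ^ j * s) :
    0 < -1 * (-1) ^ j * (familyPoly k (m + 1)).eval (2 * Real.cos θ) := by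
  have hsin := Real.sin_pos_of_pos_of_lt_pi h0 hpi
  rw [← sin_mul_eval_familyPoly] at h
  refine pos_of_mul_pos_right (a := Real.sin θ) ?_ hsin.le
  have hsq : ((-1 : ℝ) ^ j) ^ 2 = 1 := by rw [← pow_mul, mul_comm, pow_mul]; simp
  have : Real.sin θ * (-1 * (-1) ^ j * (familyPoly k (m + 1)).eval (2 * Real.cos θ)) = s := by
    linear_combination -1 * (-1) ^ j * h + s * hsq
  rwa [this]

lemma cos_nat_add_half_mul_pi (j : ℕ) : Real.cos ((j + 1 / 2) * Real.pi) = 0 := by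
  rw [show ((j : ℝ) + 1 / 2) * Real.pi = j * Real.pi + Real.pi / 2 by ring,
    Real.cos_add_pi_div_two, Real.sin_nat_mul_pi, neg_zero]

lemma sin_nat_add_half_mul_pi (j : ℕ) : Real.sin ((j + 1 / 2) * Real.pi) = (-1) ^ j := by
  rw [show ((j : ℝ) + 1 / 2) * Real.pi = j * Real.pi + Real.pi / 2 by ring,
    Real.sin_add_pi_div_two, Real.cos_nat_mul_pi]

/-- Sign at a point `θ` with `c θ` an integral multiple of `π`. -/
lemma familyPoly_sign_of_mul_eq {k m j : ℕ} {θ c : ℝ} (h0 : 0 < θ) (hpi : θ < Real.pi)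
    (hc : c * θ = (j + 1) * Real.pi)
    (hpos : 0 < 2 * Real.sin θ * Real.cos ((2 * m + 1 + k - c) * θ) +
      Real.sin ((c - (2 * m + 1)) * θ)) :
    0 < -1 * (-1) ^ j * (familyPoly k (m + 1)).eval (2 * Real.cos θ) := by
  refine neg_one_pow_mul_eval_familyPoly_pos h0 hpi hpos ?_
  have hcos : Real.cos (c * θ) = -(-1) ^ j := by
    rw [hc]
    have := Real.cos_nat_mul_pi (j + 1)
    push_cast at this
    rw [this]
    ring
  have hsin : Real.sin (c * θ) = 0 := by
    rw [hc]
    exact_mod_cast Real.sin_nat_mul_pi (j + 1)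
  -- Both frequencies are expanded around `c`; the addition formulas then leave only low-frequency
  -- differences.
  rw [show (2 * (m : ℝ) + 1 + k) * θ = c * θ + (2 * m + 1 + k - c) * θ by ring,
    show (2 * (m : ℝ) + 1) * θ = c * θ - (c - (2 * m + 1)) * θ by ring, Real.cos_add,
    Real.sin_sub, hcos, hsin]
  ring

/-- Sign at a point `θ` with `c θ` a half-integral multiple of `π`. -/
lemma familyPoly_sign_of_mul_eq_half {k m j : ℕ} {θ c : ℝ} (h0 : 0 < θ) (hpi : θ < Real.pi)
    (hc : c * θ = (j + 1 / 2) * Real.pi)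
    (hpos : 0 < 2 * Real.sin θ * Real.sin ((2 * m + 1 + k - c) * θ) +
      Real.cos ((c - (2 * m + 1)) * θ)) :
    0 < -1 * (-1) ^ j * (familyPoly k (m + 1)).eval (2 * Real.cos θ) := by
  refine neg_one_pow_mul_eval_familyPoly_pos h0 hpi hpos ?_
  have hcos : Real.cos (c * θ) = 0 := by rw [hc, cos_nat_add_half_mul_pi]
  have hsin : Real.sin (c * θ) = (-1) ^ j := by rw [hc, sin_nat_add_half_mul_pi]
  rw [show (2 * (m : ℝ) + 1 + k) * θ = c * θ + (2 * m + 1 + k - c) * θ by ring,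
    show (2 * (m : ℝ) + 1) * θ = c * θ - (c - (2 * m + 1)) * θ by ring, Real.cos_add,
    Real.sin_sub, hcos, hsin]
  ring

lemma eval_zero_familyPoly (l m : ℕ) :
    (familyPoly (2 * l + 1) (m + 1)).eval 0 = (-1) ^ m * (2 * (-1) ^ (l + 1) - 1) := by
  have h := sin_mul_eval_familyPoly (2 * l + 1) m (Real.pi / 2)
  have h1 := Real.cos_nat_mul_pi (m + l + 1)
  have h2 := sin_nat_add_half_mul_pi m
  push_cast at h h1
  rw [Real.sin_pi_div_two, Real.cos_pi_div_two,
    show (2 * (m : ℝ) + 1 + (2 * l + 1)) * (Real.pi / 2) = (m + l + 1) * Real.pi by ring,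
    show (2 * (m : ℝ) + 1) * (Real.pi / 2) = (m + 1 / 2) * Real.pi by ring, h1, h2] at h
  rw [mul_zero] at h
  rw [← one_mul (eval 0 _), h]
  ring

/-! Even case. -/

/-- With `c = 2m + 1` the sine term vanishes and the factor is `2 sin θ`. -/
lemma familyPoly_zero_sign (m j : ℕ) (hj : j + 1 ≤ 2 * m) :
    0 < -1 * (-1) ^ j *
      (familyPoly 0 (m + 1)).eval (2 * Real.cos ((j + 1) / (2 * m + 1) * Real.pi)) := by
  have hj' : (j : ℝ) + 1 ≤ 2 * m := by exact_mod_cast hj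
  have h0 : 0 < ((j : ℝ) + 1) / (2 * m + 1) * Real.pi := by positivity
  have hlt : ((j : ℝ) + 1) / (2 * m + 1) < 1 := by
    rw [div_lt_one (by positivity)]; linarith
  have hpi : ((j : ℝ) + 1) / (2 * m + 1) * Real.pi < Real.pi := by nlinarith [Real.pi_pos]
  refine familyPoly_sign_of_mul_eq (c := 2 * m + 1) h0 hpi (by field_simp) ?_
  simpa using Real.sin_pos_of_pos_of_lt_pi h0 hpi

/-- Here `c = 2m + 5/2`, and `2 sin θ sin(θ/2) + cos(3θ/2)` collapses to `cos(θ/2)`. -/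
lemma familyPoly_two_sign (m j : ℕ) (hj : j ≤ 2 * m + 1) :
    0 < -1 * (-1) ^ j *
      (familyPoly 2 (m + 1)).eval (2 * Real.cos ((2 * j + 1) / (4 * m + 5) * Real.pi)) := by
  have hj' : (j : ℝ) ≤ 2 * m + 1 := by exact_mod_cast hj
  set θ := (2 * (j : ℝ) + 1) / (4 * m + 5) * Real.pi with hθ
  have h0 : 0 < θ := by positivity
  have hlt : (2 * (j : ℝ) + 1) / (4 * m + 5) < 1 := by
    rw [div_lt_one (by positivity)]; linarith
  have hpi : θ < Real.pi := by nlinarith [Real.pi_pos]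
  refine familyPoly_sign_of_mul_eq_half (c := 2 * m + 5 / 2) h0 hpi
    (by rw [hθ]; field_simp; ring) ?_
  have hcos : 0 < Real.cos (θ / 2) := Real.cos_pos_of_mem_Ioo ⟨by linarith, by linarith⟩
  have e1 : (2 * (m : ℝ) + 1 + (2 : ℕ) - (2 * m + 5 / 2)) * θ = θ / 2 := by push_cast; ring
  have e2 : (2 * (m : ℝ) + 5 / 2 - (2 * m + 1)) * θ = θ + θ / 2 := by ring
  rw [e1, e2, Real.cos_add]
  have e3 : Real.cos (θ / 2) = Real.cos θ * Real.cos (θ / 2) + Real.sin θ * Real.sin (θ / 2) := by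
    rw [← Real.cos_sub]; congr 1; ring
  linarith

/-- In the even case there are `2 m + k` roots in `(-2, 2)`, one of them close to `-2`. -/
lemma exists_interior_roots_even {k : ℕ} (hk : k = 0 ∨ k = 2) {m : ℕ} (hm : 1 ≤ m) :
    (∃ S : Finset ℝ, S.card = 2 * m + k ∧
      ∀ x ∈ S, -2 < x ∧ x < 2 ∧ (familyPoly k (m + 1)).IsRoot x) ∧
    ∃ x, x < -(2 * Real.cos (Real.pi / (2 * m + 1))) ∧ (familyPoly k (m + 1)).IsRoot x := by
  have hm' : (1 : ℝ) ≤ m := by exact_mod_cast hm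
  have hpi := Real.pi_pos
  have hcos : ∀ {a b : ℝ}, 0 ≤ a → b ≤ 1 → a < b →
      Real.cos (b * Real.pi) < Real.cos (a * Real.pi) := fun ha hb hab =>
    Real.cos_lt_cos_of_nonneg_of_le_pi (by positivity) (by nlinarith) (by nlinarith)
  have hneg2 : ∀ k : ℕ, Even k → (familyPoly k (m + 1)).eval (-2) < 0 := fun k hk => by
    rw [eval_neg_two_familyPoly hk]
    linarith
  rcases hk with rfl | rfl
  · constructor
    -- The final test point `π` is handled separately by the value at `-2`, since `sin π = 0` makes
    -- the trigonometric identity void there.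
    · obtain ⟨S, hS, h⟩ := exists_roots_of_alternating_of_last (familyPoly 0 (m + 1))
        (fun j => (j + 1) / (2 * m + 1) * Real.pi) Real.pi (2 * m - 1) (by positivity) le_rfl
        (fun j => by push_cast; gcongr; linarith) (by
          push_cast [show 1 ≤ 2 * m by omega]
          rw [mul_lt_iff_lt_one_left hpi, div_lt_one (by positivity)]
          linarith)
        (fun j hj => familyPoly_zero_sign m j (by omega)) (by
          rw [Real.cos_pi, show 2 * m - 1 + 1 = 2 * m by omega, pow_mul]
          simpa using hneg2 0 (by decide))
      refine ⟨S, by omega, fun x hx => ?_⟩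
      obtain ⟨h1, h2, h3⟩ := h x hx
      rw [Real.cos_pi] at h1
      exact ⟨by linarith, by
        linarith [Real.cos_le_one ((((0 : ℕ) : ℝ) + 1) / (2 * m + 1) * Real.pi)], h3⟩
    · have hs := familyPoly_zero_sign m (2 * m - 1) (by omega)
      -- The last grid index is odd, so the value there is positive, opposite to the sign at `-2`.
      rw [Odd.neg_one_pow ⟨m - 1, by omega⟩] at hs
      push_cast [show 1 ≤ 2 * m by omega] at hs
      rw [show (2 * (m : ℝ) - 1 + 1) / (2 * m + 1) * Real.pi =
        Real.pi - Real.pi / (2 * m + 1) by field_simp; ring, Real.cos_pi_sub] at hs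
      have hlt : -2 < 2 * -Real.cos (Real.pi / (2 * m + 1)) := by
        have := @hcos 0 (1 / (2 * m + 1)) le_rfl
          (by rw [div_le_one (by positivity)]; linarith) (by positivity)
        rw [zero_mul, Real.cos_zero, div_mul_eq_mul_div, one_mul] at this
        linarith
      obtain ⟨x, -, h2, h3⟩ := exists_root_of_eval_mul_neg (familyPoly 0 (m + 1)) hlt
        (mul_neg_of_neg_of_pos (hneg2 0 (by decide)) (by linarith))
      exact ⟨x, by linarith, h3⟩
  · constructor
    · obtain ⟨S, hS, h⟩ := exists_roots_of_alternating_of_last (familyPoly 2 (m + 1))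
        (fun j => (2 * j + 1) / (4 * m + 5) * Real.pi) Real.pi (2 * m + 1) (by positivity) le_rfl
        (fun j => by push_cast; gcongr; linarith) (by
          push_cast
          rw [mul_lt_iff_lt_one_left hpi, div_lt_one (by positivity)]
          linarith)
        (fun j hj => familyPoly_two_sign m j hj) (by
          rw [Real.cos_pi, show 2 * m + 1 + 1 = 2 * (m + 1) by omega, pow_mul]
          simpa using hneg2 2 (by decide))
      refine ⟨S, by omega, fun x hx => ?_⟩
      obtain ⟨h1, h2, h3⟩ := h x hx
      rw [Real.cos_pi] at h1
      exact ⟨by linarith, by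
        linarith [Real.cos_le_one ((2 * ((0 : ℕ) : ℝ) + 1) / (4 * m + 5) * Real.pi)], h3⟩
    · have hs := familyPoly_two_sign m (2 * m + 1) le_rfl
      rw [Odd.neg_one_pow ⟨m, by omega⟩] at hs
      push_cast at hs
      rw [show (2 * (2 * (m : ℝ) + 1) + 1) / (4 * m + 5) * Real.pi =
        Real.pi - 2 / (4 * m + 5) * Real.pi by field_simp; ring, Real.cos_pi_sub] at hs
      have hle : 2 / (4 * (m : ℝ) + 5) ≤ 1 := by rw [div_le_one (by positivity)]; linarith
      have hlt : -2 < 2 * -Real.cos (2 / (4 * m + 5) * Real.pi) := by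
        have := @hcos 0 (2 / (4 * m + 5)) le_rfl hle (by positivity)
        rw [zero_mul, Real.cos_zero] at this
        linarith
      obtain ⟨x, -, h2, h3⟩ := exists_root_of_eval_mul_neg (familyPoly 2 (m + 1)) hlt
        (mul_neg_of_neg_of_pos (hneg2 2 (by decide)) (by linarith))
      -- The last grid point for `k = 2` is even closer to `-2`, so the bound from `k = 0` serves
      -- both cases.
      have := @hcos (2 / (4 * m + 5)) (1 / (2 * m + 1)) (by positivity)
        (by rw [div_le_one (by positivity)]; linarith)
        (by rw [div_lt_div_iff₀ (by positivity) (by positivity)]; linarith)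
      rw [div_mul_eq_mul_div 1, one_mul] at this
      exact ⟨x, by linarith, h3⟩

/-! Odd case. -/

/-- The factor is `3 sin θ`; the index `j = m` is the angle `π / 2`, so no separate last point is
needed. -/
lemma familyPoly_one_sign (m j : ℕ) (hj : j ≤ m) :
    0 < -1 * (-1) ^ j *
      (familyPoly 1 (m + 1)).eval (2 * Real.cos ((j + 1) / (2 * m + 2) * Real.pi)) := by
  have hj' : (j : ℝ) ≤ m := by exact_mod_cast hj
  set θ := ((j : ℝ) + 1) / (2 * m + 2) * Real.pi with hθ
  have h0 : 0 < θ := by positivity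
  have hlt : ((j : ℝ) + 1) / (2 * m + 2) < 1 := by
    rw [div_lt_one (by positivity)]; linarith
  have hpi : θ < Real.pi := by nlinarith [Real.pi_pos]
  refine familyPoly_sign_of_mul_eq (c := 2 * m + 2) h0 hpi (by rw [hθ]; field_simp) ?_
  have hsin := Real.sin_pos_of_pos_of_lt_pi h0 hpi
  have e1 : (2 * (m : ℝ) + 1 + (1 : ℕ) - (2 * m + 2)) * θ = 0 := by push_cast; ring
  have e2 : (2 * (m : ℝ) + 2 - (2 * m + 1)) * θ = θ := by ring
  rw [e1, e2, Real.cos_zero]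
  linarith

/-- The factor is `2 sin 2θ`, which vanishes at `π / 2`; that endpoint is covered by
`eval_zero_familyPoly`. -/
lemma familyPoly_three_sign (m j : ℕ) (hj : j ≤ m) :
    0 < -1 * (-1) ^ j *
      (familyPoly 3 (m + 1)).eval (2 * Real.cos ((j + 1) / (2 * m + 3) * Real.pi)) := by
  have hj' : (j : ℝ) ≤ m := by exact_mod_cast hj
  set θ := ((j : ℝ) + 1) / (2 * m + 3) * Real.pi with hθ
  have h0 : 0 < θ := by positivity
  have hlt : ((j : ℝ) + 1) / (2 * m + 3) < 1 / 2 := by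
    rw [div_lt_div_iff₀ (by positivity) (by positivity)]; linarith
  have hpi : θ < Real.pi / 2 := by nlinarith [Real.pi_pos]
  refine familyPoly_sign_of_mul_eq (c := 2 * m + 3) h0 (by linarith)
    (by rw [hθ]; field_simp) ?_
  have hsin := Real.sin_pos_of_pos_of_lt_pi h0 (by linarith)
  have hcos : 0 < Real.cos θ := Real.cos_pos_of_mem_Ioo ⟨by linarith, by linarith⟩
  have e1 : (2 * (m : ℝ) + 1 + (3 : ℕ) - (2 * m + 3)) * θ = θ := by push_cast; ring
  have e2 : (2 * (m : ℝ) + 3 - (2 * m + 1)) * θ = 2 * θ := by ring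
  rw [e1, e2, Real.sin_two_mul]
  positivity

/-- The factor is `2 sin θ sin 2θ + cos 3θ = cos θ`, again zero at `π / 2`. -/
lemma familyPoly_five_sign (m j : ℕ) (hj : j ≤ m + 1) :
    0 < -1 * (-1) ^ j *
      (familyPoly 5 (m + 1)).eval (2 * Real.cos ((2 * j + 1) / (4 * m + 8) * Real.pi)) := by
  have hj' : (j : ℝ) ≤ m + 1 := by exact_mod_cast hj
  set θ := (2 * (j : ℝ) + 1) / (4 * m + 8) * Real.pi with hθ
  have h0 : 0 < θ := by positivity
  have hlt : (2 * (j : ℝ) + 1) / (4 * m + 8) < 1 / 2 := by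
    rw [div_lt_div_iff₀ (by positivity) (by positivity)]; linarith
  have hpi : θ < Real.pi / 2 := by nlinarith [Real.pi_pos]
  refine familyPoly_sign_of_mul_eq_half (c := 2 * m + 4) h0 (by linarith)
    (by rw [hθ]; field_simp; ring) ?_
  have hcos : 0 < Real.cos θ := Real.cos_pos_of_mem_Ioo ⟨by linarith, by linarith⟩
  have e1 : (2 * (m : ℝ) + 1 + (5 : ℕ) - (2 * m + 4)) * θ = 2 * θ := by push_cast; ring
  have e2 : (2 * (m : ℝ) + 4 - (2 * m + 1)) * θ = θ + 2 * θ := by ring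
  rw [e1, e2, Real.cos_add]
  have e3 : Real.cos θ = Real.cos θ * Real.cos (2 * θ) + Real.sin θ * Real.sin (2 * θ) := by
    rw [← Real.cos_sub, ← Real.cos_neg]; congr 1; ring
  linarith

lemma familyPoly_seven_sign_eq {m : ℕ} {θ : ℝ} :
    2 * Real.sin θ * Real.sin ((2 * m + 1 + (7 : ℕ) - (2 * m + 5)) * θ) +
      Real.cos ((2 * m + 5 - (2 * m + 1)) * θ) = Real.cos (2 * θ) := by
  have e1 : (2 * (m : ℝ) + 1 + (7 : ℕ) - (2 * m + 5)) * θ = 3 * θ := by push_cast; ring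
  have e2 : (2 * (m : ℝ) + 5 - (2 * m + 1)) * θ = θ + 3 * θ := by ring
  rw [e1, e2, Real.cos_add]
  have e3 : Real.cos (2 * θ) = Real.cos θ * Real.cos (3 * θ) + Real.sin θ * Real.sin (3 * θ) := by
    rw [← Real.cos_sub, ← Real.cos_neg]; congr 1; ring
  linarith

lemma familyPoly_seven_sign_of_lt (m j : ℕ) (hj : 2 * j ≤ m + 1) :
    0 < -1 * (-1) ^ j *
      (familyPoly 7 (m + 1)).eval (2 * Real.cos ((2 * j + 1) / (4 * m + 10) * Real.pi)) := by
  have hj' : 2 * (j : ℝ) ≤ m + 1 := by exact_mod_cast hj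
  set θ := (2 * (j : ℝ) + 1) / (4 * m + 10) * Real.pi with hθ
  have h0 : 0 < θ := by positivity
  have hlt : (2 * (j : ℝ) + 1) / (4 * m + 10) < 1 / 4 := by
    rw [div_lt_div_iff₀ (by positivity) (by positivity)]; linarith
  have hpi : θ < Real.pi / 4 := by nlinarith [Real.pi_pos]
  refine familyPoly_sign_of_mul_eq_half (c := 2 * m + 5) h0 (by linarith)
    (by rw [hθ]; field_simp; ring) ?_
  rw [familyPoly_seven_sign_eq]
  exact Real.cos_pos_of_mem_Ioo ⟨by linarith, by linarith⟩

/-- Beyond `π / 4` the factor `cos 2θ` is negative, which shifts the sign pattern by one index. -/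
lemma familyPoly_seven_sign_of_gt (m j : ℕ) (hj : m + 2 ≤ 2 * j) (hj2 : j ≤ m + 2) :
    0 < -1 * (-1) ^ (j + 1) *
      (familyPoly 7 (m + 1)).eval (2 * Real.cos ((2 * j + 1) / (4 * m + 10) * Real.pi)) := by
  have hj' : (m : ℝ) + 2 ≤ 2 * j := by exact_mod_cast hj
  have hj2' : (j : ℝ) ≤ m + 2 := by exact_mod_cast hj2
  set θ := (2 * (j : ℝ) + 1) / (4 * m + 10) * Real.pi with hθ
  have h0 : 0 < θ := by positivity
  have hlt : 1 / 4 < (2 * (j : ℝ) + 1) / (4 * m + 10) := by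
    rw [div_lt_div_iff₀ (by positivity) (by positivity)]; linarith
  have hle : (2 * (j : ℝ) + 1) / (4 * m + 10) ≤ 1 / 2 := by
    rw [div_le_div_iff₀ (by positivity) (by positivity)]; linarith
  have hpi : Real.pi / 4 < θ := by nlinarith [Real.pi_pos]
  have hpi2 : θ ≤ Real.pi / 2 := by nlinarith [Real.pi_pos]
  have hcos : Real.cos (2 * θ) < 0 :=
    Real.cos_neg_of_pi_div_two_lt_of_lt (by linarith) (by linarith)
  have hsin : Real.sin ((2 * (m : ℝ) + 5) * θ) = (-1) ^ j := by
    rw [← sin_nat_add_half_mul_pi j, hθ]; congr 1; field_simp; ring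
  have hcos' : Real.cos ((2 * (m : ℝ) + 5) * θ) = 0 := by
    rw [← cos_nat_add_half_mul_pi j, hθ]; congr 1; field_simp; ring
  refine neg_one_pow_mul_eval_familyPoly_pos (s := -Real.cos (2 * θ)) h0 (by linarith)
    (by linarith) ?_
  rw [← @familyPoly_seven_sign_eq m θ,
    show (2 * (m : ℝ) + 1 + (7 : ℕ)) * θ =
      (2 * m + 5) * θ + (2 * m + 1 + (7 : ℕ) - (2 * m + 5)) * θ by ring,
    show (2 * (m : ℝ) + 1) * θ = (2 * m + 5) * θ - (2 * m + 5 - (2 * m + 1)) * θ by ring,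
    Real.cos_add, Real.sin_sub, hcos', hsin]
  ring

/-- At `π / 4` the factor `cos 2θ` vanishes, so the sign is computed directly. The index `a = ⌈m/2⌉`
is that of the last grid point before `π / 4`. -/
lemma familyPoly_seven_sign_middle (m a : ℕ) (ha : 2 * a = m ∨ 2 * a = m + 1) :
    0 < -1 * (-1) ^ (a + 1) * (familyPoly 7 (m + 1)).eval (2 * Real.cos (Real.pi / 4)) := by
  have hpi := Real.pi_pos
  have hs : 0 < √2 / 2 := by positivity
  refine neg_one_pow_mul_eval_familyPoly_pos (s := √2 / 2) (by positivity) (by linarith) hs ?_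
  have ha1 := Real.cos_nat_mul_pi a
  have ha2 := Real.sin_nat_mul_pi a
  rw [Real.sin_pi_div_four]
  rcases ha with rfl | ha
  · push_cast
    rw [show (2 * (2 * (a : ℝ)) + 1 + 7) * (Real.pi / 4) = a * Real.pi + 2 * Real.pi by ring,
      show (2 * (2 * (a : ℝ)) + 1) * (Real.pi / 4) = a * Real.pi + Real.pi / 4 by ring,
      Real.cos_add_two_pi, Real.sin_add, ha1, ha2, Real.sin_pi_div_four]
    ring
  · have hm : (m : ℝ) = 2 * a - 1 := by
      have : (2 * a : ℝ) = m + 1 := by exact_mod_cast ha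
      linarith
    push_cast
    rw [hm, show (2 * (2 * (a : ℝ) - 1) + 1 + 7) * (Real.pi / 4) =
        a * Real.pi + Real.pi / 2 + Real.pi by ring,
      show (2 * (2 * (a : ℝ) - 1) + 1) * (Real.pi / 4) = a * Real.pi - Real.pi / 4 by ring,
      Real.cos_add_pi, Real.cos_add_pi_div_two, Real.sin_sub, ha1, ha2, Real.sin_pi_div_four]
    ring

lemma exists_positive_roots_seven (m : ℕ) :
    ∃ S : Finset ℝ, S.card = m + 3 ∧ ∀ x ∈ S, 0 < x ∧ x < 2 ∧ (familyPoly 7 (m + 1)).IsRoot x := by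
  have hpi := Real.pi_pos
  obtain ⟨a, ha⟩ : ∃ a, 2 * a = m ∨ 2 * a = m + 1 := ⟨(m + 1) / 2, by omega⟩
  have haR : (m : ℝ) ≤ 2 * a ∧ 2 * (a : ℝ) ≤ m + 1 := by
    constructor
    · exact_mod_cast (by omega : m ≤ 2 * a)
    · exact_mod_cast (by omega : 2 * a ≤ m + 1)
  let A : ℕ → ℝ := fun j => (2 * j + 1) / (4 * m + 10) * Real.pi
  have hA : ∀ j, A j < A (j + 1) := fun j => by
    simp only [A]; push_cast; gcongr; linarith
  have hlast : A (m + 2) = Real.pi / 2 := by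
    simp only [A]; push_cast; field_simp; ring
  have hA0 : 0 ≤ A 0 := by simp only [A]; positivity
  have hAa : A a < Real.pi / 4 := by
    have : (2 * (a : ℝ) + 1) / (4 * m + 10) < 1 / 4 := by
      rw [div_lt_div_iff₀ (by positivity) (by positivity)]; linarith
    simp only [A]; nlinarith
  have hAa' : Real.pi / 4 < A (a + 1) := by
    have : 1 / 4 < (2 * ((a : ℝ) + 1) + 1) / (4 * m + 10) := by
      rw [div_lt_div_iff₀ (by positivity) (by positivity)]; linarith
    simp only [A]; push_cast; nlinarith
  -- Inserting `π / 4` at index `a + 1` moves later grid points up by one, which absorbs the sign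
  -- shift and restores alternation.
  let t : ℕ → ℝ := fun j => if j ≤ a then A j else if j = a + 1 then Real.pi / 4 else A (j - 1)
  have ht0 : t 0 = A 0 := if_pos (Nat.zero_le _)
  have htl : t (m + 3) = Real.pi / 2 := by
    simp only [t]
    rw [if_neg (by omega), if_neg (by omega), ← hlast]
    rfl
  have hex := exists_roots_of_alternating (familyPoly 7 (m + 1)) (-1) t (m + 3)
    (by rwa [ht0]) (by rw [htl]; linarith) (fun j hj => ?_) (fun j hj => ?_)
  · obtain ⟨S, hS, h⟩ := hex
    refine ⟨S, hS, fun x hx => ?_⟩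
    obtain ⟨h1, h2, h3⟩ := h x hx
    rw [htl, Real.cos_pi_div_two, mul_zero] at h1
    exact ⟨h1, by linarith [Real.cos_le_one (t 0)], h3⟩
  · simp only [t]
    rcases lt_trichotomy j a with hja | rfl | hja
    · rw [if_pos (by omega), if_pos (by omega)]
      exact hA j
    · simpa using hAa
    · rw [if_neg (by omega), if_neg (by omega : ¬ j + 1 ≤ a), if_neg (by omega : j + 1 ≠ a + 1)]
      rcases Nat.lt_or_eq_of_le (Nat.succ_le_of_lt hja) with hja | rfl
      · rw [if_neg (by omega)]
        have := hA (j - 1)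
        rwa [Nat.sub_add_cancel (by omega)] at this
      · simpa using hAa'
  · simp only [t]
    split_ifs with h1 h2
    · exact familyPoly_seven_sign_of_lt m j (by omega)
    · rw [h2]
      exact familyPoly_seven_sign_middle m a ha
    · obtain ⟨i, rfl⟩ : ∃ i, j = i + 1 := ⟨j - 1, by omega⟩
      exact familyPoly_seven_sign_of_gt m i (by omega) (by omega)

/-- In the odd case `k = 2 l + 1` there are `m + l` roots in `(0, 2)`. -/
lemma exists_positive_roots_odd {l : ℕ} (hl : l = 0 ∨ l = 1 ∨ l = 2 ∨ l = 3) (m : ℕ) :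
    ∃ S : Finset ℝ, S.card = m + l ∧
      ∀ x ∈ S, 0 < x ∧ x < 2 ∧ (familyPoly (2 * l + 1) (m + 1)).IsRoot x := by
  have hpi := Real.pi_pos
  have hsq : ((-1 : ℝ) ^ m) ^ 2 = 1 := by rw [← pow_mul, mul_comm, pow_mul]; simp
  rcases hl with rfl | rfl | rfl | rfl
  · obtain ⟨S, hS, h⟩ := exists_roots_of_alternating (familyPoly 1 (m + 1)) (-1)
      (fun j => (j + 1) / (2 * m + 2) * Real.pi) m (by positivity)
      (by
        have : ((m : ℝ) + 1) / (2 * m + 2) ≤ 1 := by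
          rw [div_le_one (by positivity)]; linarith
        nlinarith)
      (fun j hj => by push_cast; gcongr; linarith) (fun j hj => familyPoly_one_sign m j hj)
    refine ⟨S, hS, fun x hx => ?_⟩
    obtain ⟨h1, h2, h3⟩ := h x hx
    rw [show ((m : ℝ) + 1) / (2 * m + 2) * Real.pi = Real.pi / 2 by field_simp,
      Real.cos_pi_div_two, mul_zero] at h1
    exact ⟨h1, by linarith [Real.cos_le_one ((((0 : ℕ) : ℝ) + 1) / (2 * m + 2) * Real.pi)], h3⟩
  · obtain ⟨S, hS, h⟩ := exists_roots_of_alternating_of_last (familyPoly 3 (m + 1))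
      (fun j => (j + 1) / (2 * m + 3) * Real.pi) (Real.pi / 2) m (by positivity)
      (by linarith) (fun j => by push_cast; gcongr; linarith)
      (by
        have : ((m : ℝ) + 1) / (2 * m + 3) < 1 / 2 := by
          rw [div_lt_div_iff₀ (by positivity) (by positivity)]; linarith
        nlinarith)
      (fun j hj => familyPoly_three_sign m j hj)
      (by
        rw [Real.cos_pi_div_two, mul_zero, eval_zero_familyPoly 1]
        ring_nf
        rw [mul_comm m, pow_mul]
        simp)
    refine ⟨S, hS, fun x hx => ?_⟩
    obtain ⟨h1, h2, h3⟩ := h x hx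
    rw [Real.cos_pi_div_two, mul_zero] at h1
    exact ⟨h1, by linarith [Real.cos_le_one ((((0 : ℕ) : ℝ) + 1) / (2 * m + 3) * Real.pi)], h3⟩
  · obtain ⟨S, hS, h⟩ := exists_roots_of_alternating_of_last (familyPoly 5 (m + 1))
      (fun j => (2 * j + 1) / (4 * m + 8) * Real.pi) (Real.pi / 2) (m + 1) (by positivity)
      (by linarith) (fun j => by push_cast; gcongr; linarith)
      (by
        have : (2 * ((m : ℝ) + 1) + 1) / (4 * m + 8) < 1 / 2 := by
          rw [div_lt_div_iff₀ (by positivity) (by positivity)]; linarith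
        push_cast
        nlinarith)
      (fun j hj => familyPoly_five_sign m j hj)
      (by
        rw [Real.cos_pi_div_two, mul_zero, eval_zero_familyPoly 2]
        ring_nf
        rw [mul_comm m, pow_mul]
        simp)
    refine ⟨S, hS, fun x hx => ?_⟩
    obtain ⟨h1, h2, h3⟩ := h x hx
    rw [Real.cos_pi_div_two, mul_zero] at h1
    exact ⟨h1, by linarith [Real.cos_le_one ((2 * ((0 : ℕ) : ℝ) + 1) / (4 * m + 8) * Real.pi)],
      h3⟩
  · exact exists_positive_roots_seven m

/-! The polynomial for `n = 1`, which has no exterior root. -/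

/-- The polynomial is `T_{k+1} - 1`, with values `2(-1)^j - 1` at the angles `jπ/(k+1)`: all `k + 1`
roots are interior, for every `k`. -/
lemma isHyperbolic_familyPoly_one (k : ℕ) : IsHyperbolic (familyPoly k 1) := by
  have hpi := Real.pi_pos
  have hex := exists_roots_of_alternating (familyPoly k (0 + 1)) 1
    (fun j => j / (k + 1) * Real.pi) (k + 1) (by simp) (by push_cast; field_simp; rfl)
    (fun j hj => by push_cast; gcongr; linarith) (fun j hj => ?_)
  · obtain ⟨S, hS, h⟩ := hex
    refine isHyperbolic_of_natDegree_le_card (familyPoly_ne_zero k 0) S (fun x hx => (h x hx).2.2) ?_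
    exact (natDegree_familyPoly_le k 0).trans (by omega)
  · rw [familyPoly_succ, chebBasis_of_ne_zero (by omega), mul_zero, zero_add, eval_sub,
      Chebyshev.C_two_mul_real_cos]
    push_cast
    rw [show (1 + (k : ℝ)) * (j / (k + 1) * Real.pi) = j * Real.pi by
      field_simp; ring, Real.cos_nat_mul_pi]
    simp [chebBasis]
    rcases neg_one_pow_eq_or ℝ j with h | h <;> rw [h] <;> norm_num

/-! ### The root multiset -/

/-- The roots of the family for `n = m + 1 ≥ 2`: all are simple, and all but one (`k` even) or two
(`k` odd) lie in `[-2, 2]`. -/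
lemma exists_roots_familyPoly {k : ℕ} (hk : k ∈ ({0, 1, 2, 3, 5, 7} : Finset ℕ)) {m : ℕ}
    (hm : 1 ≤ m) : IsHyperbolic (familyPoly k (m + 1)) ∧ ∃ x : ℝ, 2 < x ∧ ∃ S : Finset ℝ,
      (∀ s ∈ S, s ∈ Set.Icc (-2 : ℝ) 2) ∧
      (familyPoly k (m + 1)).roots = (if Even k then {x} else {x, -x}) + S.val := by
  obtain ⟨x, hx, hroot⟩ := exists_root_familyPoly_gt_two (k := k) hm
  have hdeg := natDegree_familyPoly_le k m
  have hp := familyPoly_ne_zero k m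
  have hcases : (k = 0 ∨ k = 2) ∨ ∃ l, (l = 0 ∨ l = 1 ∨ l = 2 ∨ l = 3) ∧ k = 2 * l + 1 := by
    simp only [Finset.mem_insert, Finset.mem_singleton] at hk
    rcases hk with h | h | h | h | h | h
    · exact Or.inl (Or.inl h)
    · exact Or.inr ⟨0, by simp, h⟩
    · exact Or.inl (Or.inr h)
    · exact Or.inr ⟨1, by simp, h⟩
    · exact Or.inr ⟨2, by simp, h⟩
    · exact Or.inr ⟨3, by simp, h⟩
  rcases hcases with hk | ⟨l, hl, rfl⟩
  · have hev : Even k := by rcases hk with rfl | rfl <;> decide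
    obtain ⟨S, hcard, hS⟩ := (exists_interior_roots_even hk hm).1
    have hxS : x ∉ S := fun h => by linarith [(hS x h).2.1]
    have hR : ∀ y ∈ insert x S, (familyPoly k (m + 1)).IsRoot y := by
      intro y hy
      rcases Finset.mem_insert.1 hy with rfl | hy
      · exact hroot
      · exact (hS y hy).2.2
    have hRcard : (familyPoly k (m + 1)).natDegree ≤ (insert x S).card := by
      rw [Finset.card_insert_of_notMem hxS]
      omega
    refine ⟨isHyperbolic_of_natDegree_le_card hp _ hR hRcard, x, hx, S,
      fun s hs => ⟨(hS s hs).1.le, (hS s hs).2.1.le⟩, ?_⟩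
    rw [roots_eq_val_of_natDegree_le_card hp _ hR hRcard, if_pos hev,
      Finset.insert_val_of_notMem hxS, Multiset.singleton_add]
  · have hodd : Odd (2 * l + 1) := ⟨l, rfl⟩
    have hneg : ∀ y, (familyPoly (2 * l + 1) (m + 1)).IsRoot y →
        (familyPoly (2 * l + 1) (m + 1)).IsRoot (-y) := fun y hy => by
      rwa [IsRoot.def, eval_neg_familyPoly hodd]
    -- The `m + l` positive roots, their negatives and `±x` make `2m + 2l + 2`, the degree.
    obtain ⟨S, hcard, hS⟩ := exists_positive_roots_odd hl m
    have himage : ∀ y ∈ S.image Neg.neg, -y ∈ S := by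
      intro y hy
      obtain ⟨s, hs, rfl⟩ := Finset.mem_image.1 hy
      rwa [neg_neg]
    have hdisj : Disjoint S (S.image Neg.neg) := by
      refine Finset.disjoint_left.2 fun y hy hy' => ?_
      linarith [(hS y hy).1, (hS _ (himage y hy')).1]
    have hT : ∀ y ∈ S ∪ S.image Neg.neg, y ∈ Set.Icc (-2 : ℝ) 2 ∧
        (familyPoly (2 * l + 1) (m + 1)).IsRoot y := by
      intro y hy
      rcases Finset.mem_union.1 hy with hy | hy
      · obtain ⟨h1, h2, h3⟩ := hS y hy
        exact ⟨⟨by linarith, h2.le⟩, h3⟩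
      · obtain ⟨h1, h2, h3⟩ := hS _ (himage y hy)
        exact ⟨⟨by linarith, by linarith⟩, by simpa using hneg _ h3⟩
    have hTcard : (S ∪ S.image Neg.neg).card = 2 * (m + l) := by
      rw [Finset.card_union_of_disjoint hdisj, Finset.card_image_of_injective _ neg_injective,
        hcard]
      ring
    set T := S ∪ S.image Neg.neg
    have hxT : -x ∉ T := fun h => by linarith [(hT _ h).1.1]
    have hxT' : x ∉ insert (-x) T := fun h => by
      rcases Finset.mem_insert.1 h with h | h
      · linarith
      · linarith [(hT _ h).1.2]
    have hR : ∀ y ∈ insert x (insert (-x) T), (familyPoly (2 * l + 1) (m + 1)).IsRoot y := by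
      intro y hy
      rcases Finset.mem_insert.1 hy with rfl | hy
      · exact hroot
      rcases Finset.mem_insert.1 hy with rfl | hy
      · exact hneg _ hroot
      · exact (hT y hy).2
    have hRcard : (familyPoly (2 * l + 1) (m + 1)).natDegree ≤
        (insert x (insert (-x) T)).card := by
      rw [Finset.card_insert_of_notMem hxT', Finset.card_insert_of_notMem hxT]
      omega
    refine ⟨isHyperbolic_of_natDegree_le_card hp _ hR hRcard, x, hx, T,
      fun s hs => (hT s hs).1, ?_⟩
    rw [roots_eq_val_of_natDegree_le_card hp _ hR hRcard, if_neg (Nat.not_even_iff_odd.2 hodd),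
      Finset.insert_val_of_notMem hxT', Finset.insert_val_of_notMem hxT]
    rw [Multiset.insert_eq_cons, Multiset.cons_add, Multiset.singleton_add]

/-- The exterior root, the least root, and the bounds on the latter which determine its limit. -/
lemma exists_extreme_roots_familyPoly {k : ℕ} (hk : k ∈ ({0, 1, 2, 3, 5, 7} : Finset ℕ)) {m : ℕ}
    (hm : 1 ≤ m) : ∃ x y : ℝ, 2 < x ∧
      (familyPoly k (m + 1)).roots.filter (fun x => x ∉ Set.Icc (-2 : ℝ) 2) =
        (if Even k then {x} else {x, -x}) ∧
      IsLeast {x : ℝ | (familyPoly k (m + 1)).IsRoot x} y ∧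
      (if Even k then -2 ≤ y ∧ y ≤ -(2 * Real.cos (Real.pi / (2 * m + 1))) else y = -x) ∧
      ∀ z, 2 < z → (familyPoly k (m + 1)).IsRoot z → z = x := by
  obtain ⟨-, x, hx, S, hS, hroots⟩ := exists_roots_familyPoly hk hm
  have hp := familyPoly_ne_zero k m
  have hmem : ∀ z, (familyPoly k (m + 1)).IsRoot z ↔
      z ∈ (if Even k then {x} else {x, -x} : Multiset ℝ) ∨ z ∈ S := fun z => by
    rw [← mem_roots hp, hroots, Multiset.mem_add, Finset.mem_val]
  have hfilter : (familyPoly k (m + 1)).roots.filter (fun x => x ∉ Set.Icc (-2 : ℝ) 2) =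
      (if Even k then {x} else {x, -x}) := by
    rw [hroots, Multiset.filter_add, Multiset.filter_eq_self.2, Multiset.filter_eq_nil.2, add_zero]
    · exact fun s hs h => h (hS s hs)
    · intro z hz h
      split_ifs at hz
      · rw [Multiset.mem_singleton] at hz
        linarith [h.2]
      · simp only [Multiset.insert_eq_cons, Multiset.mem_cons, Multiset.mem_singleton] at hz
        rcases hz with rfl | rfl
        · linarith [h.2]
        · linarith [h.1]
  have huniq : ∀ z, 2 < z → (familyPoly k (m + 1)).IsRoot z → z = x := by
    intro z hz h
    rcases (hmem z).1 h with h | h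
    · split_ifs at h
      · exact Multiset.mem_singleton.1 h
      · simp only [Multiset.insert_eq_cons, Multiset.mem_cons, Multiset.mem_singleton] at h
        rcases h with h | h
        · exact h
        · linarith
    · linarith [(hS z h).2]
  by_cases hev : Even k
  · simp only [hev, if_true] at hfilter hmem ⊢
    have hk' : k = 0 ∨ k = 2 := by
      simp only [Finset.mem_insert, Finset.mem_singleton] at hk
      rcases hk with rfl | rfl | rfl | rfl | rfl | rfl <;> revert hev <;> decide
    obtain ⟨w, hw, hwroot⟩ := (exists_interior_roots_even hk' hm).2
    obtain ⟨y, hy, hmin⟩ := (familyPoly k (m + 1)).roots.toFinset.exists_minimal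
      ⟨w, by simpa [hp] using hwroot⟩
    have hy' : (familyPoly k (m + 1)).IsRoot y := by simpa [hp] using hy
    have hleast : ∀ z, (familyPoly k (m + 1)).IsRoot z → y ≤ z := fun z hz => by
      by_contra! h
      exact h.not_ge (hmin (by simpa [hp] using hz) h.le)
    refine ⟨x, y, hx, hfilter, ⟨hy', hleast⟩, ⟨?_, (hleast w hwroot).trans hw.le⟩, huniq⟩
    rcases (hmem y).1 hy' with h | h
    · rw [Multiset.mem_singleton] at h
      linarith
    · exact (hS y h).1
  · simp only [hev, if_false] at hfilter hmem ⊢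
    refine ⟨x, -x, hx, hfilter, ⟨(hmem _).2 (by simp), fun z hz => ?_⟩, rfl, huniq⟩
    rcases (hmem z).1 hz with h | h
    · simp only [Multiset.insert_eq_cons, Multiset.mem_cons, Multiset.mem_singleton] at h
      rcases h with h | h <;> linarith
    · linarith [(hS z h).1]

/-- `xM n` is the root larger than `2` and `xm n` the smallest root of `familyPoly k n`. The
roots outside `[-2, 2]` are counted with multiplicity. -/
theorem mainTheorem1 (k : ℕ) (hk : k ∈ ({0, 1, 2, 3, 5, 7} : Finset ℕ)) :
    (∀ n : ℕ, 1 ≤ n → IsHyperbolic (familyPoly k n)) ∧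
    ∃ z₀ : ℝ, IsGreatest {z : ℝ | (limitPoly k).IsRoot z} z₀ ∧
      ∃ xM xm : ℕ → ℝ,
        (∀ n : ℕ, 2 ≤ n →
          2 < xM n ∧
          (familyPoly k n).roots.filter (fun x => x ∉ Set.Icc (-2 : ℝ) 2) =
            (if Even k then {xM n} else {xM n, -xM n}) ∧
          IsLeast {x : ℝ | (familyPoly k n).IsRoot x} (xm n)) ∧
        Tendsto xM atTop (𝓝 (z₀ + z₀⁻¹)) ∧
        Tendsto xm atTop (𝓝 (if Even k then -2 else -(z₀ + z₀⁻¹))) := by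
  obtain ⟨z₀, hz1, hgreatest, hg, hneg⟩ := exists_isGreatest_root_limitPoly k
  refine ⟨fun n hn => ?_, z₀, hgreatest, ?_⟩
  · rcases Nat.lt_or_eq_of_le hn with hn | rfl
    · obtain ⟨m, rfl⟩ : ∃ m, n = m + 1 := ⟨n - 1, by omega⟩
      exact (exists_roots_familyPoly hk (by omega)).1
    · exact isHyperbolic_familyPoly_one k
  have hex : ∀ n : ℕ, ∃ x y : ℝ, 2 ≤ n → _ := fun n => by
    by_cases hn : 2 ≤ n
    · obtain ⟨x, y, h⟩ := exists_extreme_roots_familyPoly hk (m := n - 1) (by omega)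
      exact ⟨x, y, fun _ => h⟩
    -- The values for `n < 2` are arbitrary and do not affect the limits.
    · exact ⟨0, 0, fun h => absurd h hn⟩
  choose xM xm h using hex
  have h' : ∀ m, 1 ≤ m → _ := fun m hm => h (m + 1) (by omega)
  simp only [Nat.add_sub_cancel] at h'
  have hM : Tendsto xM atTop (𝓝 (z₀ + z₀⁻¹)) :=
    tendsto_exterior_root hz1 hg hneg fun m hm => (h' m hm).2.2.2.2
  refine ⟨xM, xm, fun n hn => ?_, hM, ?_⟩
  · obtain ⟨m, rfl⟩ : ∃ m, n = m + 1 := ⟨n - 1, by omega⟩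
    obtain ⟨h1, h2, h3, -⟩ := h' m (by omega)
    exact ⟨h1, h2, h3⟩
  · rw [← tendsto_add_atTop_iff_nat 1]
    by_cases hev : Even k
    · simp only [hev, if_true] at h' ⊢
      have hangle : Tendsto (fun m : ℕ => Real.pi / (2 * (m : ℝ) + 1)) atTop (𝓝 0) :=
        tendsto_const_nhds.div_atTop (tendsto_atTop_add_const_right _ _
          (tendsto_natCast_atTop_atTop.const_mul_atTop two_pos))
      have hcos : Tendsto (fun m : ℕ => -(2 * Real.cos (Real.pi / (2 * (m : ℝ) + 1)))) atTop
          (𝓝 (-2)) := by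
        have := (((Real.continuous_cos.tendsto 0).comp hangle).const_mul 2).neg
        simpa using this
      refine tendsto_of_tendsto_of_tendsto_of_le_of_le' tendsto_const_nhds hcos ?_ ?_ <;>
        filter_upwards [eventually_ge_atTop 1] with m hm
      · exact (h' m hm).2.2.2.1.1
      · exact (h' m hm).2.2.2.1.2
    · simp only [hev, if_false] at h' ⊢
      refine (((tendsto_add_atTop_iff_nat 1).2 hM).neg).congr' ?_
      filter_upwards [eventually_ge_atTop 1] with m hm
      exact (h' m hm).2.2.2.1.symm
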